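/- Let $\mathcal G=(\mathcal V,\mathcal E,\mathcal W)$ be a finite connected undirected simple graph with nonzero real edge weights $\mathcal W:\mathcal E\to\mathbb R\setminus\{0\}$, let $E$ be its (oriented) incidence matrix, $W$ the diagonal matrix of the edge weights, and $L(\mathcal G)=EWE^T$ its weighted Laplacian. Assume that $\mathcal G$ contains exactly one cycle, that exactly one edge $e_-=\{u,v\}$ has negative weight, that the graph $\mathcal G_+$ obtained from $\mathcal G$ by deleting $e_-$ is connected, and that $|\mathcal W(e_-)|=\mathcal R_{uv}(\mathcal G_+)^{-1}$, where $\mathcal R_{uv}(\mathcal G_+)=(\mathbf e_u-\mathbf e_v)^TL(\mathcal G_+)^\dagger(\mathbf e_u-\mathbf e_v)$ is the effective resistance between $u$ and $v$ in $\mathcal G_+$ and $\dagger$ denotes the Moore–Penrose pseudo-inverse. Let $\mathcal H$ be the graph obtained from $\mathcal G$ by deleting all edges of the cycle (keeping all nodes), and let $q$ be the number of its connected components. Then for every initial condition $x(0)\in\mathbb R^{\mathcal V}$ the consensus protocol $\dot x(t)=-L(\mathcal G)x(t)$, $t\ge 0$, has a trajectory, and every trajectory converges as $t\to\infty$ to a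 limit $y\in\mathbb R^{\mathcal V}$ which is constant on each connected component of $\mathcal H$. Moreover there is a linear hyperplane $N\subset\mathbb R^{\mathcal V}$ (a subspace of dimension $|\mathcal V|-1$), depending only on $\mathcal G$, such that: - if $x(0)\notin N$, the agents form exactly $q$ clusters, namely the components of $\mathcal H$: $y_i=y_j$ if and only if $i$ and $j$ lie in the same component of $\mathcal H$, so that $y$ takes exactly $q$ distinct values; - if $x(0)\in N$, all agents agree on the average of the initial states: $y_i=\frac1{|\mathcal V|}\sum_{j}x_j(0)$ for every $i$. -/

import Mathlib

/-- An undirected weighted graph: a simple graph with a nonzero real weight, of either sign, on each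
edge. Only the values of `weight` on edges are ever used. -/
structure WeightedGraph (V : Type*) where
  graph : SimpleGraph V
  weight : Sym2 V → ℝ
  weight_ne_zero : ∀ e ∈ graph.edgeSet, weight e ≠ 0

/-- `B` is a Moore–Penrose pseudo-inverse of the real matrix `A`. -/
structure IsMoorePenroseInverse {m n : Type*} [Fintype m] [Fintype n]
    (A : Matrix m n ℝ) (B : Matrix n m ℝ) : Prop where
  mul_mul_self : A * B * A = A
  self_mul_mul : B * A * B = B
  symm_left : (A * B).transpose = A * B
  symm_right : (B * A).transpose = B * A

/-- The Moore–Penrose pseudo-inverse is unique. -/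
theorem IsMoorePenroseInverse.unique {m n : Type*} [Fintype m] [Fintype n]
    {A : Matrix m n ℝ} {B C : Matrix n m ℝ}
    (hB : IsMoorePenroseInverse A B) (hC : IsMoorePenroseInverse A C) : B = C := by
  have h1 : A * B = A * C := by
    calc A * B = (A * C * A) * B := by rw [hC.mul_mul_self]
      _ = (A * C) * (A * B) := by simp only [Matrix.mul_assoc]
      _ = (A * C).transpose * (A * B).transpose := by rw [hC.symm_left, hB.symm_left]
      _ = ((A * B) * (A * C)).transpose := by rw [Matrix.transpose_mul (A * B)]
      _ = ((A * B * A) * C).transpose := by simp only [Matrix.mul_assoc]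
      _ = A * C := by rw [hB.mul_mul_self, hC.symm_left]
  have h2 : B * A = C * A := by
    calc B * A = B * (A * C * A) := by rw [hC.mul_mul_self]
      _ = (B * A) * (C * A) := by simp only [Matrix.mul_assoc]
      _ = (B * A).transpose * (C * A).transpose := by rw [hC.symm_right, hB.symm_right]
      _ = ((C * A) * (B * A)).transpose := by rw [Matrix.transpose_mul (C * A)]
      _ = (C * (A * B * A)).transpose := by simp only [Matrix.mul_assoc]
      _ = C * A := by rw [hB.mul_mul_self, hC.symm_right]
  calc B = B * A * B := hB.self_mul_mul.symm
    _ = C * (A * B) := by rw [h2, Matrix.mul_assoc]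
    _ = C := by rw [h1, ← Matrix.mul_assoc, hC.self_mul_mul]

/-- Every real symmetric matrix has a Moore–Penrose pseudo-inverse. -/
theorem exists_isMoorePenroseInverse {n : Type*} [Fintype n]
    {A : Matrix n n ℝ} (hA : A.IsSymm) : ∃ B, IsMoorePenroseInverse A B := by
  classical
  have hH : A.IsHermitian := by
    rw [Matrix.IsHermitian, Matrix.conjTranspose_eq_transpose_of_trivial]; exact hA
  obtain ⟨U, d, hU, hA'⟩ : ∃ (U : Matrix n n ℝ) (d : n → ℝ),
      U.transpose * U = 1 ∧ A = U * Matrix.diagonal d * U.transpose := by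
    refine ⟨hH.eigenvectorUnitary, hH.eigenvalues, ?_, ?_⟩
    · have := Unitary.coe_star_mul_self hH.eigenvectorUnitary
      rwa [Matrix.star_eq_conjTranspose, Matrix.conjTranspose_eq_transpose_of_trivial] at this
    · have := hH.spectral_theorem
      rw [Unitary.conjStarAlgAut_apply, Matrix.star_eq_conjTranspose,
        Matrix.conjTranspose_eq_transpose_of_trivial] at this
      exact this
  have key : ∀ a b : n → ℝ, (U * Matrix.diagonal a * U.transpose) *
      (U * Matrix.diagonal b * U.transpose) =
        U * Matrix.diagonal (fun i => a i * b i) * U.transpose := by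
    intro a b
    calc _ = U * Matrix.diagonal a * (U.transpose * U) * Matrix.diagonal b * U.transpose := by
          simp only [Matrix.mul_assoc]
      _ = _ := by rw [hU, Matrix.mul_one, Matrix.mul_assoc U, Matrix.diagonal_mul_diagonal]
  have hs : ∀ a : n → ℝ, (U * Matrix.diagonal a * U.transpose).transpose =
      U * Matrix.diagonal a * U.transpose := by
    intro a
    simp [Matrix.transpose_mul, Matrix.mul_assoc]
  refine ⟨U * Matrix.diagonal (fun i => (d i)⁻¹) * U.transpose, ?_, ?_, ?_, ?_⟩
  · rw [hA', key, key]; simp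
  · rw [hA', key, key]
    have : (fun i => (d i)⁻¹ * d i * (d i)⁻¹) = fun i => (d i)⁻¹ := by
      funext i
      by_cases h : d i = 0 <;> simp [h]
    rw [this]
  · rw [hA', key, hs]
  · rw [hA', key, hs]

/-- The Moore–Penrose pseudo-inverse of a real symmetric matrix. -/
noncomputable def moorePenroseInverse {n : Type*} [Fintype n]
    {A : Matrix n n ℝ} (hA : A.IsSymm) : Matrix n n ℝ :=
  (exists_isMoorePenroseInverse hA).choose

/-- `C` is the set of edges of a cycle of `G`. Two cycles are the same subgraph exactly when they
have the same edges, whatever their base points and directions. -/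
def IsCycleEdgeSet {V : Type*} (G : SimpleGraph V) (C : Set (Sym2 V)) : Prop :=
  ∃ (a : V) (p : G.Walk a a), p.IsCycle ∧ p.edgeSet = C

namespace WeightedGraph

variable {V : Type*}

open Classical in
/-- The incidence matrix `E(G)`, for an arbitrary fixed orientation of the edges. -/
noncomputable def incidence (G : WeightedGraph V) : Matrix V G.graph.edgeSet ℝ :=
  Matrix.of fun i e =>
    if i = (Quot.out (e : Sym2 V)).1 then 1 else if i = (Quot.out (e : Sym2 V)).2 then -1 else 0

open Classical in
/-- The weighted Laplacian `L(G) = E W Eᵀ`. -/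
noncomputable def laplacian [Fintype V] (G : WeightedGraph V) : Matrix V V ℝ :=
  G.incidence * Matrix.diagonal (fun e : G.graph.edgeSet => G.weight e) * G.incidence.transpose

theorem laplacian_isSymm [Fintype V] (G : WeightedGraph V) : G.laplacian.IsSymm := by
  simp [Matrix.IsSymm, laplacian, Matrix.transpose_mul, Matrix.mul_assoc]

/-- The spanning subgraph `G₊` obtained by deleting the edges of negative weight. -/
def positivePart (G : WeightedGraph V) : WeightedGraph V where
  graph := G.graph.deleteEdges {e | G.weight e < 0}
  weight := G.weight
  weight_ne_zero := fun e he =>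
    G.weight_ne_zero e (SimpleGraph.edgeSet_mono (SimpleGraph.deleteEdges_le _) he)

/-- The effective resistance `(e_u - e_v)ᵀ L(G)† (e_u - e_v)`. -/
noncomputable def effectiveResistance [Fintype V] (G : WeightedGraph V) (u v : V) : ℝ :=
  let P := moorePenroseInverse G.laplacian_isSymm
  P u u - 2 * P u v + P v v

/-- `x` is a trajectory on `[0, ∞)` of the consensus protocol `ẋ = -L(G) x`. -/
def IsConsensusTrajectory [Fintype V] (G : WeightedGraph V) (x : ℝ → V → ℝ) : Prop :=
  IsIntegralCurveOn x (fun _ y => -(G.laplacian.mulVec y)) (Set.Ici 0)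

end WeightedGraph

/-- The limit configuration `y` of the agents `V` consists of the clusters given by the connected
components of `H`: two agents have the same limit state if and only if they lie in the same
component. -/
def IsClusteredBy {V : Type*} (H : SimpleGraph V) (y : V → ℝ) : Prop :=
  ∀ i j, y i = y j ↔ H.connectedComponentMk i = H.connectedComponentMk j

/-! The flow of a positive semidefinite symmetric matrix converges to the orthogonal projection of
the initial state on its kernel (`IsIntegralCurveOn.exists_tendsto_of_isSymm`), so everything rests
on the kernel of `L(G)`.

Let `z` be the potential in `G₊` of a unit current sent from `u` to `v`; its drop `z u - z v` is the
effective resistance. At the critical weight the negative edge carries exactly this current back, so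
`z` is harmonic for `G`, the form of `L(G)` is still nonnegative, and its kernel is spanned by `z`
and the constants (`laplacian_of_critical_weight`).

Since `G` has a single cycle, `G₊` is a tree and the cycle is the negative edge together with the
path from `u` to `v` in `G₊`. The current makes `z` strictly decrease along this path, while the
edges off the cycle are bridges and carry none. The level sets of `z` are thus the components of `H`
(`isClusteredBy_potential`).

The limit is the average plus a multiple of `z` minus its mean. That multiple vanishes exactly when
`x(0)` is orthogonal to the centred potential, which defines `N`. -/

open Matrix Filter

/-! ### Linear flows of symmetric matrices -/

/-- A real symmetric matrix has an orthonormal basis of eigenvectors. -/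
theorem Matrix.IsSymm.exists_eigenvector_expansion {n : Type*} [Fintype n]
    {A : Matrix n n ℝ} (hA : A.IsSymm) :
    ∃ (b : n → n → ℝ) (d : n → ℝ), (∀ w, w = ∑ i, (w ⬝ᵥ b i) • b i) ∧
      (∀ i, b i ⬝ᵥ b i = 1) ∧ ∀ i, A *ᵥ b i = d i • b i := by
  classical
  have hH : A.IsHermitian := by
    rw [Matrix.IsHermitian, Matrix.conjTranspose_eq_transpose_of_trivial]; exact hA
  obtain ⟨U, d, hU, hd⟩ : ∃ (U : Matrix n n ℝ) (d : n → ℝ),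
      Uᵀ * U = 1 ∧ ∀ i, A *ᵥ (Uᵀ i) = d i • Uᵀ i := by
    refine ⟨hH.eigenvectorUnitary, hH.eigenvalues, ?_, hH.mulVec_eigenvectorBasis⟩
    have := Unitary.coe_star_mul_self hH.eigenvectorUnitary
    rwa [Matrix.star_eq_conjTranspose, Matrix.conjTranspose_eq_transpose_of_trivial] at this
  refine ⟨Uᵀ, d, fun w => ?_, fun i => ?_, hd⟩
  · have h : U *ᵥ (Uᵀ *ᵥ w) = w := by rw [mulVec_mulVec, mul_eq_one_comm.1 hU, one_mulVec]
    conv_lhs => rw [← h]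
    ext j
    simp only [Finset.sum_apply, Pi.smul_apply, smul_eq_mul]
    refine Finset.sum_congr rfl fun i _ => ?_
    rw [mul_comm, dotProduct_comm]
    rfl
  · have := congrFun (congrFun hU i) i
    simpa [Matrix.mul_apply, dotProduct] using this

theorem HasDerivWithinAt.dotProduct_const {n : Type*} [Fintype n] {x : ℝ → n → ℝ} {x' : n → ℝ}
    {s : Set ℝ} {t : ℝ} (hx : HasDerivWithinAt x x' s t) (k : n → ℝ) :
    HasDerivWithinAt (fun t => x t ⬝ᵥ k) (x' ⬝ᵥ k) s t :=
  HasDerivWithinAt.fun_sum fun i _ => (hasDerivWithinAt_pi.1 hx i).mul_const (k i)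

theorem Matrix.IsSymm.mulVec_dotProduct {n : Type*} [Fintype n] {A : Matrix n n ℝ}
    (hA : A.IsSymm) (x y : n → ℝ) : (A *ᵥ x) ⬝ᵥ y = x ⬝ᵥ (A *ᵥ y) := by
  rw [Matrix.dotProduct_mulVec, ← Matrix.mulVec_transpose, hA.eq]

/-- Along a solution of `ẋ = -A x`, the component on an eigenvector decays exponentially. -/
theorem IsIntegralCurveOn.dotProduct_eigenvector {n : Type*} [Fintype n] {A : Matrix n n ℝ}
    (hA : A.IsSymm) {x : ℝ → n → ℝ}
    (hx : IsIntegralCurveOn x (fun _ y => -(A *ᵥ y)) (Set.Ici 0)) {k : n → ℝ} {d : ℝ}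
    (hk : A *ᵥ k = d • k) {t : ℝ} (ht : 0 ≤ t) :
    x t ⬝ᵥ k = Real.exp (-(d * t)) * (x 0 ⬝ᵥ k) := by
  -- Integrating factor: `exp (d s)` cancels the decay of the component.
  have hd : ∀ s ∈ Set.Ici (0 : ℝ),
      HasDerivWithinAt (fun s => Real.exp (d * s) * (x s ⬝ᵥ k)) 0 (Set.Ici 0) s := by
    intro s hs
    have h1 := (hx s hs).dotProduct_const k
    have h2 : HasDerivWithinAt (fun s => Real.exp (d * s)) (Real.exp (d * s) * (d * 1))
        (Set.Ici 0) s := (((hasDerivAt_id s).const_mul d).exp).hasDerivWithinAt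
    refine (h2.mul h1).congr_deriv ?_
    rw [neg_dotProduct, hA.mulVec_dotProduct, hk, dotProduct_smul, smul_eq_mul]
    ring
  have hc := constant_of_has_deriv_right_zero (a := 0) (b := t)
    (f := fun s => Real.exp (d * s) * (x s ⬝ᵥ k))
    (fun s hs => ((hd s hs.1).continuousWithinAt).mono Set.Icc_subset_Ici_self)
    (fun s hs => (hd s hs.1).mono (Set.Ici_subset_Ici.2 hs.1)) t ⟨ht, le_rfl⟩
  simp only [mul_zero, Real.exp_zero, one_mul] at hc
  rw [← hc, ← mul_assoc, ← Real.exp_add]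
  simp

/-- The linear system `ẋ = -A x` with symmetric `A` has a solution for each initial condition. -/
theorem Matrix.IsSymm.exists_isIntegralCurveOn {n : Type*} [Fintype n] {A : Matrix n n ℝ}
    (hA : A.IsSymm) (x₀ : n → ℝ) :
    ∃ x : ℝ → n → ℝ, IsIntegralCurveOn x (fun _ y => -(A *ᵥ y)) (Set.Ici 0) ∧ x 0 = x₀ := by
  obtain ⟨b, d, hexp, -, hd⟩ := hA.exists_eigenvector_expansion
  refine ⟨fun t => ∑ i, (Real.exp (-d i * t) * (x₀ ⬝ᵥ b i)) • b i, fun t _ => ?_, ?_⟩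
  · have h : HasDerivAt (fun t => ∑ i, (Real.exp (-d i * t) * (x₀ ⬝ᵥ b i)) • b i)
        (∑ i, (Real.exp (-d i * t) * (-d i * 1) * (x₀ ⬝ᵥ b i)) • b i) t :=
      HasDerivAt.fun_sum fun i _ =>
        (((((hasDerivAt_id t).const_mul (-d i)).exp).mul_const _).smul_const _)
    convert h.hasDerivWithinAt using 1
    simp only [mulVec_sum, mulVec_smul, hd, smul_smul, ← Finset.sum_neg_distrib, ← neg_smul]
    refine Finset.sum_congr rfl fun i _ => ?_
    congr 1
    ring
  · conv_rhs => rw [hexp x₀]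
    simp

/-- Every solution of `ẋ = -A x`, for `A` symmetric positive semidefinite, converges to the
orthogonal projection of its initial value on the kernel of `A`. -/
theorem IsIntegralCurveOn.exists_tendsto_of_isSymm {n : Type*} [Fintype n] {A : Matrix n n ℝ}
    (hA : A.IsSymm) (hpos : ∀ k, 0 ≤ k ⬝ᵥ (A *ᵥ k)) {x : ℝ → n → ℝ}
    (hx : IsIntegralCurveOn x (fun _ y => -(A *ᵥ y)) (Set.Ici 0)) :
    ∃ y, Tendsto x atTop (nhds y) ∧ A *ᵥ y = 0 ∧
      ∀ k, A *ᵥ k = 0 → y ⬝ᵥ k = x 0 ⬝ᵥ k := by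
  classical
  obtain ⟨b, d, hexp, hnorm, hd⟩ := hA.exists_eigenvector_expansion
  have hd0 : ∀ i, 0 ≤ d i := fun i => by
    have := hpos (b i)
    rwa [hd, dotProduct_smul, hnorm, smul_eq_mul, mul_one] at this
  -- As `t → ∞`, `exp (-d t)` tends to 1 if `d = 0` and to 0 if `d > 0`: only the kernel components
  -- survive.
  have hlim : Tendsto x atTop
      (nhds (∑ i, ((if d i = 0 then 1 else 0) * (x 0 ⬝ᵥ b i)) • b i)) := by
    have hev : (fun t => ∑ i, (Real.exp (-(d i * t)) * (x 0 ⬝ᵥ b i)) • b i) =ᶠ[atTop] x := by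
      filter_upwards [eventually_ge_atTop 0] with t ht
      rw [hexp (x t)]
      exact Finset.sum_congr rfl fun i _ => by rw [hx.dotProduct_eigenvector hA (hd i) ht]
    refine Tendsto.congr' hev (tendsto_finsetSum _ fun i _ => ?_)
    refine Tendsto.smul_const (Tendsto.mul_const _ ?_) _
    split_ifs with h
    · simp [h]
    · exact Real.tendsto_exp_neg_atTop_nhds_zero.comp
        (tendsto_id.const_mul_atTop (lt_of_le_of_ne (hd0 i) (Ne.symm h)))
  refine ⟨_, hlim, ?_, fun k hk => ?_⟩
  · simp only [mulVec_sum, mulVec_smul, hd, smul_smul]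
    refine Finset.sum_eq_zero fun i _ => ?_
    split_ifs with h <;> simp [h]
  · have h1 : Tendsto (fun t => x t ⬝ᵥ k) atTop (nhds (_ ⬝ᵥ k)) :=
      ((continuous_id.dotProduct continuous_const).tendsto _).comp hlim
    -- A kernel vector is an eigenvector for 0, so the component along it is conserved.
    refine tendsto_nhds_unique h1 (tendsto_const_nhds.congr' ?_)
    filter_upwards [eventually_ge_atTop 0] with t ht
    rw [hx.dotProduct_eigenvector hA (d := 0) (by rw [hk, zero_smul]) ht]
    simp

/-! ### The Laplacian form, cuts and bridges -/

/-- The product `(x a - x b) * (y a - y b)` of the differences of `x` and `y` across `s(a, b)`. -/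
def edgeDiffMul {V : Type*} (x y : V → ℝ) : Sym2 V → ℝ :=
  Sym2.lift ⟨fun a b => (x a - x b) * (y a - y b), fun a b => by ring⟩

@[simp]
theorem edgeDiffMul_mk {V : Type*} (x y : V → ℝ) (a b : V) :
    edgeDiffMul x y s(a, b) = (x a - x b) * (y a - y b) := rfl

theorem edgeDiffMul_self_nonneg {V : Type*} (x : V → ℝ) (e : Sym2 V) : 0 ≤ edgeDiffMul x x e := by
  induction e with | h a b => exact mul_self_nonneg _

namespace WeightedGraph

variable {V : Type*} [Fintype V]

theorem transpose_incidence_mulVec (G : WeightedGraph V) (x : V → ℝ) (e : G.graph.edgeSet) :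
    (G.incidenceᵀ *ᵥ x) e = x (Quot.out (e : Sym2 V)).1 - x (Quot.out (e : Sym2 V)).2 := by
  classical
  have hne : (Quot.out (e : Sym2 V)).1 ≠ (Quot.out (e : Sym2 V)).2 := by
    have h : s((Quot.out (e : Sym2 V)).1, (Quot.out (e : Sym2 V)).2) ∈ G.graph.edgeSet := by
      have : s((Quot.out (e : Sym2 V)).1, (Quot.out (e : Sym2 V)).2) = (e : Sym2 V) :=
        Quot.out_eq (e : Sym2 V)
      rw [this]; exact e.2
    exact G.graph.ne_of_adj h
  have : ∀ i, G.incidenceᵀ e i = (Pi.single (Quot.out (e : Sym2 V)).1 1 : V → ℝ) i -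
      (Pi.single (Quot.out (e : Sym2 V)).2 1 : V → ℝ) i := by
    intro i
    simp only [incidence, transpose_apply, of_apply, Pi.single_apply]
    split_ifs with h1 h2 <;> first | (exact absurd (h1.symm.trans h2) hne) | simp
  rw [mulVec, show G.incidenceᵀ e = _ from funext this]
  rw [← Pi.sub_def, sub_dotProduct]
  simp

-- Each term is symmetric in the two ends, so the orientation disappears. Summing over all of `Sym2
-- V` lets graphs with different edge sets be compared term by term.
open Classical in
theorem dotProduct_laplacian_mulVec (G : WeightedGraph V) (x y : V → ℝ) :
    y ⬝ᵥ (G.laplacian *ᵥ x) =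
      ∑ e : Sym2 V, if e ∈ G.graph.edgeSet then G.weight e * edgeDiffMul y x e else 0 := by
  have h1 : y ⬝ᵥ (G.laplacian *ᵥ x) =
      ∑ e : G.graph.edgeSet, G.weight e * edgeDiffMul y x e := by
    rw [laplacian, ← mulVec_mulVec, ← mulVec_mulVec, dotProduct_mulVec, ← mulVec_transpose]
    refine Finset.sum_congr rfl fun e _ => ?_
    have he : edgeDiffMul y x e = edgeDiffMul y x
        s((Quot.out (e : Sym2 V)).1, (Quot.out (e : Sym2 V)).2) :=
      congrArg _ (Quot.out_eq (e : Sym2 V)).symm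
    rw [mulVec_diagonal, transpose_incidence_mulVec, transpose_incidence_mulVec, he,
      edgeDiffMul_mk]
    ring
  rw [h1, ← Finset.sum_filter]
  exact (Finset.sum_subtype _ (by simp) (fun e => G.weight e * edgeDiffMul y x e)).symm

theorem laplacian_mulVec_const (G : WeightedGraph V) (c : ℝ) :
    G.laplacian *ᵥ (fun _ => c) = 0 := by
  classical
  refine dotProduct_eq_zero _ fun y => ?_
  rw [dotProduct_comm, dotProduct_laplacian_mulVec]
  refine Finset.sum_eq_zero fun e _ => ?_
  induction e with | h a b => simp

theorem dotProduct_laplacian_mulVec_nonneg {G : WeightedGraph V}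
    (hG : ∀ e ∈ G.graph.edgeSet, 0 < G.weight e) (x : V → ℝ) :
    0 ≤ x ⬝ᵥ (G.laplacian *ᵥ x) := by
  classical
  rw [dotProduct_laplacian_mulVec]
  refine Finset.sum_nonneg fun e _ => ?_
  split_ifs with he
  · exact mul_nonneg (hG e he).le (edgeDiffMul_self_nonneg x e)
  · exact le_rfl

/-- The Laplacian form of a connected graph with positive weights vanishes on constants only. -/
theorem eq_of_dotProduct_laplacian_mulVec_eq_zero {G : WeightedGraph V}
    (hG : ∀ e ∈ G.graph.edgeSet, 0 < G.weight e) (hconn : G.graph.Connected) {x : V → ℝ}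
    (hx : x ⬝ᵥ (G.laplacian *ᵥ x) = 0) (i j : V) : x i = x j := by
  classical
  rw [dotProduct_laplacian_mulVec, Finset.sum_eq_zero_iff_of_nonneg] at hx
  · obtain ⟨p⟩ := hconn i j
    induction p with
    | nil => rfl
    | @cons a b _ h _ ih =>
      have := hx s(a, b) (Finset.mem_univ _)
      rw [if_pos (by exact h), edgeDiffMul_mk] at this
      have hw := (hG s(a, b) h).ne'
      rw [← ih]
      simpa [hw, sub_eq_zero] using this
  · intro e _
    split_ifs with he
    · exact mul_nonneg (hG e he).le (edgeDiffMul_self_nonneg x e)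
    · exact le_rfl

open Classical in
/-- Testing the Laplacian against the indicator of one side of a bridge leaves only the flow
through the bridge. -/
theorem indicator_dotProduct_laplacian_mulVec (G : WeightedGraph V) {a b : V}
    (hab : G.graph.Adj a b) (hbr : G.graph.IsBridge s(a, b)) (x : V → ℝ) :
    ({i | (G.graph.deleteEdges {s(a, b)}).Reachable a i}.indicator 1) ⬝ᵥ (G.laplacian *ᵥ x) =
      G.weight s(a, b) * (x a - x b) := by
  rw [dotProduct_laplacian_mulVec, Finset.sum_eq_single s(a, b)]
  · rw [SimpleGraph.isBridge_iff] at hbr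
    simp [hab, hbr]
  · intro e _ hne
    split_ifs with he
    · induction e with | h c d =>
      have hadj : (G.graph.deleteEdges {s(a, b)}).Adj c d := by
        rw [SimpleGraph.deleteEdges_adj]
        exact ⟨he, hne⟩
      have : (G.graph.deleteEdges {s(a, b)}).Reachable a c ↔
          (G.graph.deleteEdges {s(a, b)}).Reachable a d :=
        ⟨fun h => h.trans hadj.reachable, fun h => h.trans hadj.symm.reachable⟩
      simp [Set.indicator_apply, this]
    · rfl
  · simp

/-- A harmonic vector takes equal values at the two ends of a bridge. -/
theorem eq_of_isBridge_of_laplacian_mulVec_eq_zero (G : WeightedGraph V) {a b : V}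
    (hab : G.graph.Adj a b) (hbr : G.graph.IsBridge s(a, b)) {x : V → ℝ}
    (hx : G.laplacian *ᵥ x = 0) : x a = x b := by
  have := G.indicator_dotProduct_laplacian_mulVec hab hbr x
  rw [hx, dotProduct_zero] at this
  have hw := G.weight_ne_zero s(a, b) hab
  simpa [hw, sub_eq_zero, eq_comm] using this

/-! ### Potentials of unit flows -/

/-- The potential of a unit flow from `u` to `v` strictly decreases along each path from `u` to `v`
of an acyclic graph. -/
theorem lt_of_isPath_of_isAcyclic {G : WeightedGraph V} [DecidableEq V]
    (hG : ∀ e ∈ G.graph.edgeSet, 0 < G.weight e) (hac : G.graph.IsAcyclic) {u v : V}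
    {p : G.graph.Walk u v} (hp : p.IsPath) {z : V → ℝ}
    (hz : G.laplacian *ᵥ z = Pi.single u 1 - Pi.single v 1) {k : ℕ} (hk : k < p.length) :
    z (p.getVert (k + 1)) < z (p.getVert k) := by
  have hadj := p.adj_getVert_succ hk
  have hbr := SimpleGraph.isAcyclic_iff_forall_isBridge.1 hac (e := s(_, _)) hadj
  have hcut := G.indicator_dotProduct_laplacian_mulVec hadj hbr z
  have hinj := hp.getVert_injOn
  -- The part of the path before the edge avoids it, since a path does not repeat `getVert (k + 1)`;
  -- symmetrically for the part after it.
  have hu : (G.graph.deleteEdges {s(p.getVert k, p.getVert (k + 1))}).Reachable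
      (p.getVert k) u := by
    refine ⟨((p.take k).toDeleteEdge _ fun h => ?_).reverse⟩
    have := (p.take k).snd_mem_support_of_mem_edges h
    obtain ⟨m, hm, -⟩ := SimpleGraph.Walk.mem_support_iff_exists_getVert.1 this
    rw [SimpleGraph.Walk.take_getVert] at hm
    have := hinj (by simp; omega) (by simp; omega) hm
    omega
  have hv : (G.graph.deleteEdges {s(p.getVert k, p.getVert (k + 1))}).Reachable
      (p.getVert (k + 1)) v := by
    refine ⟨((p.drop (k + 1)).toDeleteEdge _ fun h => ?_)⟩
    have := (p.drop (k + 1)).fst_mem_support_of_mem_edges h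
    obtain ⟨m, hm, hle⟩ := SimpleGraph.Walk.mem_support_iff_exists_getVert.1 this
    rw [SimpleGraph.Walk.drop_getVert] at hm
    rw [SimpleGraph.Walk.drop_length] at hle
    have := hinj (by simp; omega) (by simp; omega) hm
    omega
  have hv' : ¬ (G.graph.deleteEdges {s(p.getVert k, p.getVert (k + 1))}).Reachable
      (p.getVert k) v := fun h => hbr (h.trans hv.symm)
  -- The side of `u` contains the source but not the sink, so the flow through the bridge is 1.
  rw [hz, dotProduct_sub, dotProduct_single_one, dotProduct_single_one,
    Set.indicator_of_mem (by exact hu), Set.indicator_of_notMem (by exact hv')] at hcut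
  have hw := hG s(_, _) hadj
  simp only [Pi.one_apply, sub_zero] at hcut
  have : 0 < z (p.getVert k) - z (p.getVert (k + 1)) := by
    by_contra! h
    have := mul_nonpos_of_nonneg_of_nonpos hw.le h
    linarith
  linarith

/-- The potential of a unit flow from `u` to `v` is injective on each path from `u` to `v` of an
acyclic graph. -/
theorem eq_of_mem_support_of_isAcyclic {G : WeightedGraph V} [DecidableEq V]
    (hG : ∀ e ∈ G.graph.edgeSet, 0 < G.weight e) (hac : G.graph.IsAcyclic) {u v : V}
    {p : G.graph.Walk u v} (hp : p.IsPath) {z : V → ℝ}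
    (hz : G.laplacian *ᵥ z = Pi.single u 1 - Pi.single v 1) {i j : V} (hi : i ∈ p.support)
    (hj : j ∈ p.support) (hij : z i = z j) : i = j := by
  have hlt : ∀ m n, m < n → n ≤ p.length → z (p.getVert n) < z (p.getVert m) := by
    intro m n hmn
    induction n, hmn using Nat.le_induction with
    | base => exact fun h => lt_of_isPath_of_isAcyclic hG hac hp hz h
    | succ n _ ih =>
      exact fun h => (lt_of_isPath_of_isAcyclic hG hac hp hz h).trans (ih (by omega))
  obtain ⟨m, rfl, hm⟩ := SimpleGraph.Walk.mem_support_iff_exists_getVert.1 hi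
  obtain ⟨n, rfl, hn⟩ := SimpleGraph.Walk.mem_support_iff_exists_getVert.1 hj
  rcases lt_trichotomy m n with h | h | h
  · exact absurd hij (hlt m n h hn).ne'
  · rw [h]
  · exact absurd hij (hlt n m h hm).ne

/-- In a connected graph with positive weights, the pseudo-inverse of the Laplacian produces the
potential of the unit flow from `u` to `v`, whose voltage drop is the effective resistance. -/
theorem exists_potential {G : WeightedGraph V} [DecidableEq V]
    (hG : ∀ e ∈ G.graph.edgeSet, 0 < G.weight e) (hconn : G.graph.Connected) (u v : V) :
    ∃ z : V → ℝ, G.laplacian *ᵥ z = Pi.single u 1 - Pi.single v 1 ∧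
      z u - z v = G.effectiveResistance u v := by
  set A := G.laplacian with hA
  set P := moorePenroseInverse G.laplacian_isSymm with hP
  have hAs : Aᵀ = A := G.laplacian_isSymm
  have hMP : IsMoorePenroseInverse A P :=
    (exists_isMoorePenroseInverse G.laplacian_isSymm).choose_spec
  -- `Pᵀ` is also a pseudo-inverse of `A = Aᵀ`; uniqueness gives symmetry.
  have hPs : Pᵀ = P := by
    refine IsMoorePenroseInverse.unique (A := A) ⟨?_, ?_, ?_, ?_⟩ hMP
    · simpa [hAs, Matrix.mul_assoc] using congrArg transpose hMP.mul_mul_self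
    · simpa [hAs, Matrix.mul_assoc] using congrArg transpose hMP.self_mul_mul
    · have := hMP.symm_right
      rw [transpose_mul, hAs] at this
      rw [this, ← this, transpose_mul, transpose_transpose, hAs]
      exact this.symm
    · have := hMP.symm_left
      rw [transpose_mul, hAs] at this
      rw [this, ← this, transpose_mul, transpose_transpose, hAs]
      exact this.symm
  have hcomm : A * P = P * A := by
    have := hMP.symm_left
    rw [transpose_mul, hAs, hPs] at this
    exact this.symm
  set b : V → ℝ := Pi.single u 1 - Pi.single v 1 with hb
  refine ⟨P *ᵥ b, ?_, ?_⟩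
  -- The residual lies in the kernel, hence is constant; it also sums to zero, as `b` and the range
  -- of `A` do. So it vanishes.
  · set r := b - A *ᵥ (P *ᵥ b) with hr
    have hAr : A *ᵥ r = 0 := by
      rw [hr, mulVec_sub, mulVec_mulVec, mulVec_mulVec, Matrix.mul_assoc, hcomm,
        ← Matrix.mul_assoc, hMP.mul_mul_self, sub_self]
    have hconst : ∀ i j, r i = r j :=
      eq_of_dotProduct_laplacian_mulVec_eq_zero hG hconn (by rw [← hA, hAr, dotProduct_zero])
    have hsum : (fun _ => (1 : ℝ)) ⬝ᵥ r = 0 := by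
      rw [hr, dotProduct_sub, ← G.laplacian_isSymm.mulVec_dotProduct, laplacian_mulVec_const,
        zero_dotProduct, hb, dotProduct_sub, dotProduct_single_one, dotProduct_single_one]
      simp
    have hr0 : r u = 0 := by
      have h : (fun _ => (1 : ℝ)) ⬝ᵥ r = Fintype.card V * r u := by
        simp [dotProduct, fun i => hconst i u]
      rw [h] at hsum
      have : Nonempty V := ⟨u⟩
      simpa [Fintype.card_ne_zero] using hsum
    have : r = 0 := funext fun i => (hconst i u).trans hr0
    exact (sub_eq_zero.1 this).symm
  · have hvu : P v u = P u v := congrFun (congrFun hPs u) v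
    simp only [effectiveResistance, ← hP, hb, mulVec_sub, mulVec_single_one,
      Pi.sub_apply, col_apply, hvu]
    ring

end WeightedGraph

/-! ### The critical weight and the unique cycle -/

namespace WeightedGraph

variable {V : Type*}

theorem positivePart_weight_pos (G : WeightedGraph V) :
    ∀ e ∈ G.positivePart.graph.edgeSet, 0 < G.positivePart.weight e := by
  intro e he
  have h : e ∈ G.graph.edgeSet ∧ ¬ G.weight e < 0 := by
    simpa [positivePart, SimpleGraph.edgeSet_deleteEdges] using he
  exact lt_of_le_of_ne (not_lt.1 h.2) (G.weight_ne_zero e h.1).symm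

variable [Fintype V]

/-- With one negative edge `s(u, v)`, the Laplacian is a rank-one perturbation of that of the
positive part. -/
theorem dotProduct_laplacian_mulVec_eq_positivePart_add (G : WeightedGraph V) {u v : V}
    (huv : G.graph.Adj u v) (hneg : G.weight s(u, v) < 0)
    (huniq : ∀ e ∈ G.graph.edgeSet, G.weight e < 0 → e = s(u, v)) (x y : V → ℝ) :
    y ⬝ᵥ (G.laplacian *ᵥ x) = y ⬝ᵥ (G.positivePart.laplacian *ᵥ x) +
      G.weight s(u, v) * ((y u - y v) * (x u - x v)) := by
  classical
  rw [dotProduct_laplacian_mulVec, dotProduct_laplacian_mulVec, ← edgeDiffMul_mk y x u v,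
    ← Fintype.sum_ite_eq' s(u, v) (fun e => G.weight e * edgeDiffMul y x e),
    ← Finset.sum_add_distrib]
  refine Finset.sum_congr rfl fun e _ => ?_
  have hmem : e ∈ G.positivePart.graph.edgeSet ↔ e ∈ G.graph.edgeSet ∧ ¬ G.weight e < 0 := by
    simp [positivePart, SimpleGraph.edgeSet_deleteEdges]
  have hw : G.positivePart.weight e = G.weight e := rfl
  by_cases he : e = s(u, v)
  · subst he
    simp [hmem, hneg, huv]
  · have : e ∈ G.positivePart.graph.edgeSet ↔ e ∈ G.graph.edgeSet :=
      hmem.trans ⟨fun h => h.1, fun h => ⟨h, fun h' => he (huniq e h h')⟩⟩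
    simp [this, he, hw]

/-- At the critical weight, the potential `z` of the unit flow through the positive part is
harmonic, the Laplacian is positive semidefinite, and `z` and the constants span its kernel. -/
theorem laplacian_of_critical_weight (G : WeightedGraph V) [DecidableEq V] {u v : V}
    (hpos : G.positivePart.graph.Connected)
    (huv : G.graph.Adj u v) (hneg : G.weight s(u, v) < 0)
    (huniq : ∀ e ∈ G.graph.edgeSet, G.weight e < 0 → e = s(u, v)) {z : V → ℝ}
    (hz : G.positivePart.laplacian *ᵥ z = Pi.single u 1 - Pi.single v 1)
    (hw : G.weight s(u, v) * (z u - z v) = -1) :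
    G.laplacian *ᵥ z = 0 ∧ (∀ x, 0 ≤ x ⬝ᵥ (G.laplacian *ᵥ x)) ∧
      ∀ x, G.laplacian *ᵥ x = 0 → ∃ α β : ℝ, ∀ i, x i = β + α * z i := by
  have hsplit := G.dotProduct_laplacian_mulVec_eq_positivePart_add huv hneg huniq
  have hz0 : G.laplacian *ᵥ z = 0 := by
    refine dotProduct_eq_zero _ fun y => ?_
    rw [dotProduct_comm, hsplit, hz, dotProduct_sub, dotProduct_single_one, dotProduct_single_one]
    linear_combination (y u - y v) * hw
  have hR : z u - z v ≠ 0 := fun h => by rw [h, mul_zero] at hw; norm_num at hw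
  -- Subtracting a multiple of the harmonic `z` does not change the form; `α` is chosen to equalize
  -- the values at `u` and `v`, which removes the negative term.
  have hred : ∀ x : V → ℝ, ∃ α : ℝ, x ⬝ᵥ (G.laplacian *ᵥ x) =
      (x - α • z) ⬝ᵥ (G.positivePart.laplacian *ᵥ (x - α • z)) := by
    intro x
    refine ⟨(x u - x v) / (z u - z v), ?_⟩
    have h1 : ∀ α : ℝ, x ⬝ᵥ (G.laplacian *ᵥ x) =
        (x - α • z) ⬝ᵥ (G.laplacian *ᵥ (x - α • z)) := by
      intro α
      rw [mulVec_sub, mulVec_smul, hz0, smul_zero, sub_zero, sub_dotProduct, smul_dotProduct,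
        ← G.laplacian_isSymm.mulVec_dotProduct z, hz0, zero_dotProduct, smul_zero, sub_zero]
    rw [h1 ((x u - x v) / (z u - z v)), hsplit]
    have h2 : (x - ((x u - x v) / (z u - z v)) • z) u -
        (x - ((x u - x v) / (z u - z v)) • z) v = 0 := by
      simp only [Pi.sub_apply, Pi.smul_apply, smul_eq_mul]
      field_simp
      ring
    rw [h2]
    simp
  refine ⟨hz0, fun x => ?_, fun x hx => ?_⟩
  · obtain ⟨α, h⟩ := hred x
    rw [h]
    exact dotProduct_laplacian_mulVec_nonneg G.positivePart_weight_pos _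
  · obtain ⟨α, h⟩ := hred x
    rw [hx, dotProduct_zero] at h
    have hc := eq_of_dotProduct_laplacian_mulVec_eq_zero G.positivePart_weight_pos hpos h.symm
    refine ⟨α, (x - α • z) u, fun i => ?_⟩
    rw [hc u i]
    simp

/-- The potential of the unit flow through the positive part of a unicyclic graph separates exactly
the components left by deleting the edges of the cycle. -/
theorem isClusteredBy_potential (G : WeightedGraph V) [DecidableEq V]
    (hconn : G.graph.Connected) {C : Set (Sym2 V)}
    (hCuniq : ∀ D, IsCycleEdgeSet G.graph D → D = C)
    (hpos : G.positivePart.graph.Connected)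
    {u v : V} (huv : G.graph.Adj u v) (hneg : G.weight s(u, v) < 0) {z : V → ℝ}
    (hz : G.positivePart.laplacian *ᵥ z = Pi.single u 1 - Pi.single v 1)
    (hz0 : G.laplacian *ᵥ z = 0) :
    IsClusteredBy (G.graph.deleteEdges C) z := by
  have hle : G.positivePart.graph ≤ G.graph := SimpleGraph.deleteEdges_le _
  have hnot : s(u, v) ∉ G.positivePart.graph.edgeSet := by
    simp [positivePart, SimpleGraph.edgeSet_deleteEdges, hneg]
  obtain ⟨p, hp⟩ := hpos.exists_isPath u v
  have hcyc : (SimpleGraph.Walk.cons huv.symm (p.mapLe hle)).IsCycle := by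
    rw [SimpleGraph.Walk.cons_isCycle_iff]
    refine ⟨(SimpleGraph.Walk.isPath_mapLe hle).2 hp, fun h => ?_⟩
    rw [SimpleGraph.Walk.edges_mapLe_eq_edges, Sym2.eq_swap] at h
    exact hnot (p.edges_subset_edgeSet h)
  have hC : ∀ e, e ∈ C ↔ e = s(u, v) ∨ e ∈ p.edges := by
    intro e
    rw [← hCuniq _ ⟨v, _, hcyc, rfl⟩, Sym2.eq_swap]
    simp [SimpleGraph.Walk.edgeSet]
  -- A cycle of `G₊` would have edge set `C`, which contains the deleted edge `s(u, v)`.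
  have hac : G.positivePart.graph.IsAcyclic := by
    intro a c hc
    have h := hCuniq _ ⟨a, c.mapLe hle, (SimpleGraph.Walk.isCycle_mapLe hle).2 hc, rfl⟩
    have : s(u, v) ∈ (c.mapLe hle).edges := by
      have : s(u, v) ∈ (c.mapLe hle).edgeSet := by rw [h, hC]; exact Or.inl rfl
      exact this
    rw [SimpleGraph.Walk.edges_mapLe_eq_edges] at this
    exact hnot (c.edges_subset_edgeSet this)
  -- An edge outside `C` lies on no cycle, so it is a bridge.
  have hreach : ∀ i j, (G.graph.deleteEdges C).Reachable i j → z i = z j := by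
    rintro i j ⟨q⟩
    induction q with
    | nil => rfl
    | @cons a b _ h _ ih =>
      rw [SimpleGraph.deleteEdges_adj] at h
      rw [← ih]
      refine G.eq_of_isBridge_of_laplacian_mulVec_eq_zero h.1 ?_ hz0
      rw [SimpleGraph.isBridge_iff_forall_cycle_notMem (by exact h.1)]
      intro w c hc hmem
      exact h.2 (hCuniq _ ⟨w, c, hc, rfl⟩ ▸ hmem)
  have hend : ∀ a b, s(a, b) ∈ C → a ∈ p.support := by
    intro a b h
    rcases (hC _).1 h with h | h
    · rcases Sym2.eq_iff.1 h with ⟨rfl, -⟩ | ⟨rfl, -⟩ <;> simp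
    · exact p.fst_mem_support_of_mem_edges h
  -- A walk from `i` to `u` stays in one component of `H` until it first meets an edge of `C`, whose
  -- ends lie on the path.
  have hproj : ∀ i, ∃ k ∈ p.support, (G.graph.deleteEdges C).Reachable i k := by
    intro i
    obtain ⟨q⟩ := hconn i u
    have hw := p.start_mem_support
    -- The endpoint `u` must vary in the induction, so `p` is replaced by its bare support.
    revert hw
    generalize p.support = S at hend ⊢
    clear * - q hend
    intro hw
    induction q with
    | nil => exact ⟨_, hw, .rfl⟩
    | @cons a b _ h _ ih =>
      by_cases hab : s(a, b) ∈ C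
      · exact ⟨a, hend a b hab, .rfl⟩
      · obtain ⟨k, hk, hbk⟩ := ih hw
        have : (G.graph.deleteEdges C).Adj a b := SimpleGraph.deleteEdges_adj.2 ⟨h, hab⟩
        exact ⟨k, hk, this.reachable.trans hbk⟩
  intro i j
  rw [SimpleGraph.ConnectedComponent.eq]
  refine ⟨fun h => ?_, hreach i j⟩
  obtain ⟨k, hk, hik⟩ := hproj i
  obtain ⟨l, hl, hjl⟩ := hproj j
  have : k = l := eq_of_mem_support_of_isAcyclic G.positivePart_weight_pos hac hp hz hk hl
    (by rw [← hreach i k hik, ← hreach j l hjl, h])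
  subst this
  exact hik.trans hjl.symm

end WeightedGraph

/-! ### Clusters and the limit -/

/-- The number of distinct values of a clustered configuration is the number of components. -/
theorem IsClusteredBy.ncard_range {V : Type*} {H : SimpleGraph V} {y : V → ℝ}
    (hy : IsClusteredBy H y) : (Set.range y).ncard = Nat.card H.ConnectedComponent := by
  let f : H.ConnectedComponent → ℝ :=
    Quot.lift y fun i j h => (hy i j).2 (SimpleGraph.ConnectedComponent.eq.2 h)
  have hf : Function.Injective f := by
    intro c d
    induction c using Quot.ind with | mk i =>
    induction d using Quot.ind with | mk j => exact fun h => (hy i j).1 h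
  have hr : Set.range y = Set.range f := by
    refine Set.Subset.antisymm ?_ ?_
    · rintro _ ⟨i, rfl⟩
      exact ⟨H.connectedComponentMk i, rfl⟩
    · rintro _ ⟨c, rfl⟩
      induction c using Quot.ind with | mk i => exact ⟨i, rfl⟩
  rw [hr, ← Nat.card_coe_set_eq, Nat.card_range_of_injective hf]

theorem mainTheorem6 {V : Type*} [Fintype V] (G : WeightedGraph V)
    (hconn : G.graph.Connected)
    -- `C` is the edge set of the only cycle of `G`
    (C : Set (Sym2 V)) (hC : IsCycleEdgeSet G.graph C)
    (hCuniq : ∀ D, IsCycleEdgeSet G.graph D → D = C)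
    (hpos : G.positivePart.graph.Connected)
    -- `s(u, v)` is the only edge with negative weight
    (u v : V) (huv : G.graph.Adj u v) (hneg : G.weight s(u, v) < 0)
    (hneg_uniq : ∀ e ∈ G.graph.edgeSet, G.weight e < 0 → e = s(u, v))
    (hweight : |G.weight s(u, v)| = (G.positivePart.effectiveResistance u v)⁻¹) :
    -- every initial condition has a trajectory
    (∀ x₀ : V → ℝ, ∃ x : ℝ → V → ℝ, G.IsConsensusTrajectory x ∧ x 0 = x₀) ∧
    -- the hyperplane `N` of degenerate initial conditions
    ∃ N : Submodule ℝ (V → ℝ), Module.finrank ℝ N + 1 = Fintype.card V ∧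
      ∀ x : ℝ → V → ℝ, G.IsConsensusTrajectory x →
        ∃ y : V → ℝ, Filter.Tendsto x Filter.atTop (nhds y) ∧
          -- for any initial condition, agreement on each component left by deleting the cycle edges
          (∀ i j, (G.graph.deleteEdges C).Reachable i j → y i = y j) ∧
          -- outside `N`, the components are the clusters, and there are `q` of them
          (x 0 ∉ N → IsClusteredBy (G.graph.deleteEdges C) y ∧
            (Set.range y).ncard = Nat.card (G.graph.deleteEdges C).ConnectedComponent) ∧
          -- on `N`, all agents agree, on the average of the initial states
          (x 0 ∈ N → ∀ i, y i = (∑ j, x 0 j) / Fintype.card V) := by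

  classical
  obtain ⟨z, hz, hzR⟩ := WeightedGraph.exists_potential G.positivePart_weight_pos hpos u v
  have hw : G.weight s(u, v) * (z u - z v) = -1 := by
    rw [abs_of_neg hneg, ← hzR] at hweight
    -- With `0⁻¹ = 0`, zero resistance would force zero weight.
    have hR : z u - z v ≠ 0 := fun h => by
      rw [h, _root_.inv_zero] at hweight
      linarith
    rw [← neg_neg (G.weight s(u, v)), hweight]
    field_simp
  obtain ⟨hz0, hpsd, hker⟩ :=
    G.laplacian_of_critical_weight hpos huv hneg hneg_uniq hz hw
  have hcl := G.isClusteredBy_potential hconn hCuniq hpos huv hneg hz hz0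
  have hcard : (Fintype.card V : ℝ) ≠ 0 := by
    have : Nonempty V := ⟨u⟩
    exact_mod_cast Fintype.card_ne_zero
  obtain ⟨m, hm⟩ : ∃ m : ℝ, m * Fintype.card V = ∑ j, z j := ⟨_, div_mul_cancel₀ _ hcard⟩
  -- Centring makes `ζ` orthogonal to the constants, so `β` and `α` below can be read off by pairing
  -- with 1 and with `ζ`.
  let ζ : V → ℝ := fun i => z i - m
  have hζ0 : G.laplacian *ᵥ ζ = 0 := by
    have : ζ = z - fun _ => m := rfl
    rw [this, mulVec_sub, hz0, G.laplacian_mulVec_const, sub_zero]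
  have hζsum : ∑ i, ζ i = 0 := by
    simp only [ζ, Finset.sum_sub_distrib, Finset.sum_const, Finset.card_univ, nsmul_eq_mul, ← hm]
    ring
  have hζne : ζ ≠ 0 := fun h => by
    have h1 : z u - z v = 0 := by
      have h2 := congrFun h u
      have h3 := congrFun h v
      simp only [ζ, Pi.zero_apply] at h2 h3
      linarith
    rw [h1] at hw
    norm_num at hw
  have hζpos : ζ ⬝ᵥ ζ ≠ 0 := fun h => hζne (dotProduct_self_eq_zero.1 h)
  let φ : Module.Dual ℝ (V → ℝ) := dotProductBilin ℝ ℝ ζ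
  have hφ : ∀ x, φ x = ζ ⬝ᵥ x := fun x => rfl
  refine ⟨G.laplacian_isSymm.exists_isIntegralCurveOn, LinearMap.ker φ, ?_, fun x hx => ?_⟩
  · rw [Module.Dual.finrank_ker_add_one_of_ne_zero, Module.finrank_fintype_fun_eq_card]
    exact fun h => hζpos (by rw [← hφ, h]; rfl)
  obtain ⟨y, hlim, hy0, hyk⟩ :=
    IsIntegralCurveOn.exists_tendsto_of_isSymm G.laplacian_isSymm hpsd hx
  obtain ⟨α, β, hαβ⟩ : ∃ α β : ℝ, ∀ i, y i = β + α * ζ i := by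
    obtain ⟨α, β, h⟩ := hker y hy0
    exact ⟨α, β + α * m, fun i => by rw [h]; simp only [ζ]; ring⟩
  have hβ : β = (∑ j, x 0 j) / Fintype.card V := by
    have h := hyk (fun _ => 1) (G.laplacian_mulVec_const 1)
    simp only [dotProduct, mul_one, hαβ, Finset.sum_add_distrib, ← Finset.mul_sum, hζsum,
      Finset.sum_const, Finset.card_univ, nsmul_eq_mul] at h
    rw [← h]
    field_simp
    ring
  have hα : α * (ζ ⬝ᵥ ζ) = φ (x 0) := by
    rw [hφ, dotProduct_comm ζ (x 0), ← hyk ζ hζ0]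
    have h : y = (fun _ => β) + α • ζ := funext hαβ
    have h1 : (fun _ => β) ⬝ᵥ ζ = 0 := by
      rw [dotProduct, ← Finset.mul_sum, hζsum, mul_zero]
    rw [h, add_dotProduct, h1, smul_dotProduct, smul_eq_mul, zero_add]
  refine ⟨y, hlim, fun i j hij => ?_, fun hN => ?_, fun hN i => ?_⟩
  · have := (hcl i j).2 (SimpleGraph.ConnectedComponent.eq.2 hij)
    simp only [hαβ, ζ, this]
  · have hα0 : α ≠ 0 := fun h => hN (by rw [LinearMap.mem_ker, ← hα, h, zero_mul])
    have hy : IsClusteredBy (G.graph.deleteEdges C) y := fun i j => by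
      rw [← hcl i j, hαβ, hαβ]
      simp [ζ, hα0]
    exact ⟨hy, hy.ncard_range⟩
  · rw [LinearMap.mem_ker, ← hα] at hN
    have hα0 : α = 0 := (mul_eq_zero.1 hN).resolve_right hζpos
    rw [hαβ, hα0, zero_mul, add_zero, hβ]
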